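/- Let $\mathbf k$ be a field of characteristic $0$ with pairwise commuting derivations $\delta_1,\dots,\delta_m$, let $\Theta$ be the monoid of operators $\theta=\delta_1^{k_1}\cdots\delta_m^{k_m}$, and let $\mathbf k\{Y\}=\mathbf k\{y_1,\dots,y_n\}$ be the differential polynomial ring, i.e. the polynomial ring over $\mathbf k$ in the derivatives $\theta y_i$ (of order $k_1+\dots+k_m$), on which $\delta_1,\dots,\delta_m$ act naturally. Fix a ranking, i.e. a total order on the derivatives such that $\theta u\ge u$, and $u\ge v$ implies $\theta u\ge\theta v$. For $f\in\mathbf k\{Y\}\setminus\mathbf k$ let $\mathrm{ld} f$ be the highest derivative occurring in $f$ (its leader), let the initial of $f$ be the leading coefficient of $f$ as a polynomial in $\mathrm{ld} f$, and let the separant be $s_f=\partial f/\partial\,\mathrm{ld} f$. A polynomial is partially reduced w.r.t. $f$ if it contains no proper derivative of $\mathrm{ld} f$, and reduced w.r.t. $f$ if moreover its degree in $\mathrm{ld} f$ is less than that of $f$. A set $\mathbb C\subset\mathbf k\{Y\}\setminus\mathbf k$ is d-triangular if for all distinct $f,g\in\mathbb C$ the leader of $f$ is not a derivative of the leader of $g$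 (nor equal to it), and $f$ is partially reduced w.r.t. $g$. Let $H_{\mathbb C}$ be the set of initials and separants of elements of $\mathbb C$, let $H_{\mathbb C}^\infty$ be the multiplicative monoid generated by $H_{\mathbb C}$, and for an ideal $I$ let $I:H_{\mathbb C}^\infty=\{a:\ sa\in I\text{ for some }s\in H_{\mathbb C}^\infty\}$. Let $(\mathbb C)$ and $[\mathbb C]$ be the ideal and the differential ideal generated by $\mathbb C$. The set $\mathbb C$ is coherent if, for all distinct $f,g\in\mathbb C$ whose leaders have a common derivative, with $v=\theta\,\mathrm{ld} f=\theta'\,\mathrm{ld} g$ the lowest one, $s_g\,\theta f-s_f\,\theta' g\in(\phi c:\ c\in\mathbb C,\ \phi\in\Theta,\ \phi\,\mathrm{ld} c<v):H_{\mathbb C}^\infty$. A differential remainder of $f$ w.r.t. $\mathbb C$ is a $g$ that is reduced w.r.t. every element of $\mathbb C$ and satisfies $hf-g\in[\mathbb C]:H_{\mathbb C}^\infty$ for some $h\in H_{\mathbb C}^\infty$. Let $m_i(\mathbb C)$ be the maximal order of a derivative of $y_i$ occurring in $\mathbb C$ ($0$ if there is none). Let $\mathbb C$ be a coherent d-triangular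 set and $f\in\mathbf k\{Y\}$. (1) Let $g,\bar g$ be differential remainders of $f$ w.r.t. $\mathbb C$, and let $X$ be the set of derivatives occurring in $\mathbb C$ and $g$. If $u\notin X$ is a derivative and $\bar g=a_ku^k+\dots+a_0$ with $a_0,\dots,a_k$ free of $u$, then $\bar g-a_0\in(\mathbb C):H_{\mathbb C}^\infty$, and $a_0$ is also a differential remainder of $f$ w.r.t. $\mathbb C$. Likewise, if $\bar g_X$ is the sum of the terms of $\bar g$ that belong to $\mathbf k[X]$, then $\bar g-\bar g_X\in(\mathbb C):H_{\mathbb C}^\infty$, and $\bar g_X$ is a differential remainder of $f$ w.r.t. $\mathbb C$. (2) Let $p_i\ge m_i(\mathbb C)$, $i=1,\dots,n$, be integers, and assume that there exists a differential remainder of $f$ w.r.t. $\mathbb C$ that contains no derivative of $y_i$ of order greater than $p_i$, $i=1,\dots,n$. Let $g$ be any differential remainder of $f$ w.r.t. $\mathbb C$. Then the truncation of $g$, i.e. the sum of those terms of $g$ in which every derivative of each $y_i$ that occurs has order at most $p_i$, is a differential remainder of $f$ w.r.t. $\mathbb C$, in which the order of every $y_i$ does not exceed $p_i$. -/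

import Mathlib

open MvPolynomial

noncomputable section

/-- A derivative `θ y_i`: `op` is the exponent vector of the derivative operator
`θ = δ_1^{k_1} ⋯ δ_m^{k_m}` and `var` is the index `i` of the differential indeterminate. -/
@[ext]
structure Deriv (m n : ℕ) where
  op : Fin m →₀ ℕ
  var : Fin n

namespace Deriv

variable {m n : ℕ}

/-- The action `θ₁ (θ₂ y_i) = (θ₁ θ₂) y_i` of derivative operators on derivatives. -/
def shift (θ : Fin m →₀ ℕ) (u : Deriv m n) : Deriv m n := ⟨θ + u.op, u.var⟩

/-- The order `k_1 + ⋯ + k_m` of a derivative. -/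
def ord (u : Deriv m n) : ℕ := ∑ j, u.op j

/-- `v` is a derivative (possibly the trivial one) of `u`. -/
def IsDerivOf (v u : Deriv m n) : Prop := ∃ θ, v = shift θ u

/-- `v` is a proper derivative of `u`. -/
def IsProperDerivOf (v u : Deriv m n) : Prop := ∃ θ, θ ≠ 0 ∧ v = shift θ u

end Deriv

/-- The given total order on the set of derivatives is a ranking. -/
structure IsRanking (m n : ℕ) [LinearOrder (Deriv m n)] : Prop where
  le_shift : ∀ (θ : Fin m →₀ ℕ) (u : Deriv m n), u ≤ Deriv.shift θ u
  shift_mono : ∀ (θ : Fin m →₀ ℕ) (u v : Deriv m n), v ≤ u → Deriv.shift θ v ≤ Deriv.shift θ u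

/-- The ring `k{y_1, …, y_n}` of differential polynomials (for `m` derivations): commutative
polynomials over `k` in the derivatives. -/
abbrev DiffPoly (m n : ℕ) (k : Type*) [Field k] := MvPolynomial (Deriv m n) k

namespace DiffPoly

variable {m n : ℕ} {k : Type*} [Field k]

/-- Application of a derivation of `k` to all the coefficients. -/
def mapCoeff (d : Derivation ℤ k k) (f : DiffPoly m n k) : DiffPoly m n k :=
  ∑ s ∈ f.support, monomial s (d (coeff s f))

theorem coeff_mapCoeff (d : Derivation ℤ k k) (f : DiffPoly m n k) (s : Deriv m n →₀ ℕ) :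
    coeff s (mapCoeff d f) = d (coeff s f) := by
  classical
  unfold mapCoeff
  rw [coeff_sum]
  simp only [coeff_monomial]
  rw [Finset.sum_ite_eq']
  split_ifs with h
  · rfl
  · rw [notMem_support_iff.mp h, map_zero]

/-- `mapCoeff` as a derivation of the polynomial ring. -/
def coeffDerivation (d : Derivation ℤ k k) :
    Derivation ℤ (DiffPoly m n k) (DiffPoly m n k) :=
  Derivation.mk'
    (AddMonoidHom.toIntLinearMap
      { toFun := mapCoeff d
        map_zero' := by ext s; simp [coeff_mapCoeff]
        map_add' := fun f g => by ext s; simp [coeff_mapCoeff] })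
    (fun f g => by
      classical
      ext s
      change coeff s (mapCoeff d (f * g)) = coeff s (f * mapCoeff d g + g * mapCoeff d f)
      rw [mul_comm g, coeff_add, coeff_mapCoeff, coeff_mul, coeff_mul, coeff_mul, map_sum,
        ← Finset.sum_add_distrib]
      refine Finset.sum_congr rfl fun x _ => ?_
      rw [Derivation.leibniz, coeff_mapCoeff, coeff_mapCoeff, smul_eq_mul, smul_eq_mul]
      ring)

/-- The extension of the derivation `δ_j` of `k` to differential polynomials: it acts on
coefficients by `δ_j` and maps the derivative `θ y_i` to `(δ_j θ) y_i`. -/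
def deriv (δ : Fin m → Derivation ℤ k k) (j : Fin m) :
    Derivation ℤ (DiffPoly m n k) (DiffPoly m n k) :=
  coeffDerivation (δ j) +
    (mkDerivation k fun u : Deriv m n =>
      (X (Deriv.shift (Finsupp.single j 1) u) : DiffPoly m n k)).restrictScalars ℤ

/-- The action of the derivative operator `θ = δ_1^{θ 1} ⋯ δ_m^{θ m}`. -/
def applyOp (δ : Fin m → Derivation ℤ k k) (θ : Fin m →₀ ℕ) (f : DiffPoly m n k) :
    DiffPoly m n k :=
  (List.finRange m).foldr (fun j g => (deriv δ j)^[θ j] g) f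

/-- `[F]`: the smallest ideal that contains `F` and is closed under the derivations. -/
def diffIdeal (δ : Fin m → Derivation ℤ k k) (F : Set (DiffPoly m n k)) :
    Ideal (DiffPoly m n k) :=
  sInf {I | F ⊆ I ∧ ∀ j, ∀ f ∈ I, deriv δ j f ∈ I}

/-- The saturation `I : S^∞`, where `S^∞` is the multiplicative set generated by `S`
(it contains `1`). -/
def sat {R : Type*} [CommRing R] (I : Ideal R) (S : Set R) : Ideal R where
  carrier := {a | ∃ s ∈ Submonoid.closure S, s * a ∈ I}
  zero_mem' := ⟨1, one_mem _, by simp⟩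
  add_mem' := by
    rintro a b ⟨s, hs, ha⟩ ⟨t, ht, hb⟩
    refine ⟨s * t, mul_mem hs ht, ?_⟩
    have h : s * t * (a + b) = t * (s * a) + s * (t * b) := by ring
    rw [h]
    exact I.add_mem (I.mul_mem_left _ ha) (I.mul_mem_left _ hb)
  smul_mem' := by
    rintro c a ⟨s, hs, ha⟩
    refine ⟨s, hs, ?_⟩
    have h : s * (c • a) = c * (s * a) := by rw [smul_eq_mul]; ring
    rw [h]
    exact I.mul_mem_left _ ha

/-- The sum of those terms of `f` in which only derivatives from `P` occur, that is, of the
terms of `f` that belong to `k[P]`. -/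
def restrictTo (P : Set (Deriv m n)) (f : DiffPoly m n k) : DiffPoly m n k :=
  open Classical in
  ∑ s ∈ f.support.filter (fun s => (s.support : Set (Deriv m n)) ⊆ P), monomial s (coeff s f)

/-- The truncation of `f`: the sum of those terms of `f` in which only derivatives of
each `y_i` of order at most `p i` occur. -/
def truncate (p : Fin n → ℕ) (f : DiffPoly m n k) : DiffPoly m n k :=
  restrictTo {u | u.ord ≤ p u.var} f

/-- `m_i(F)`: the maximal order of a derivative of `y_i` occurring in `F`
(`0` if `y_i` does not occur in `F`, and `⊤` if the orders are unbounded). -/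
def maxOrder (i : Fin n) (F : Set (DiffPoly m n k)) : ℕ∞ :=
  ⨆ f ∈ F, ⨆ u ∈ f.vars, ⨆ _ : u.var = i, (u.ord : ℕ∞)

/-- The set of derivatives occurring in elements of `F`. -/
def derivativesIn (F : Set (DiffPoly m n k)) : Set (Deriv m n) :=
  {u | ∃ f ∈ F, u ∈ f.vars}

/-- The coefficient of `u ^ d` in `f`, viewed as a univariate polynomial in `u`. -/
def coeffIn (u : Deriv m n) (d : ℕ) (f : DiffPoly m n k) : DiffPoly m n k :=
  ∑ s ∈ f.support.filter (fun s => s u = d), monomial (s.erase u) (coeff s f)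

/-- The initial of a differential polynomial with leader `u`. -/
def initialAt (u : Deriv m n) (f : DiffPoly m n k) : DiffPoly m n k :=
  coeffIn u (degreeOf u f) f

/-- The separant of a differential polynomial with leader `u`. -/
def separantAt (u : Deriv m n) (f : DiffPoly m n k) : DiffPoly m n k :=
  pderiv u f

section Ranked

variable [LinearOrder (Deriv m n)]

/-- `u` is the leader of `f`: the derivative of highest rank that occurs in `f`. -/
def IsLeader (u : Deriv m n) (f : DiffPoly m n k) : Prop :=
  u ∈ f.vars ∧ ∀ v ∈ f.vars, v ≤ u

/-- `f` is partially reduced with respect to `g`. -/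
def PartiallyReduced (f g : DiffPoly m n k) : Prop :=
  ∀ u, IsLeader u g → ∀ v ∈ f.vars, ¬ v.IsProperDerivOf u

/-- `f` is reduced with respect to `g`. -/
def Reduced (f g : DiffPoly m n k) : Prop :=
  PartiallyReduced f g ∧ ∀ u, IsLeader u g → degreeOf u f < degreeOf u g

/-- `H_C`: the set of initials and separants of the elements of `C`. -/
def initSep (C : Set (DiffPoly m n k)) : Set (DiffPoly m n k) :=
  {h | ∃ f ∈ C, ∃ u, IsLeader u f ∧ (h = initialAt u f ∨ h = separantAt u f)}

/-- `C` is a d-triangular set: its elements are not in `k`, the leader of an element is never a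
derivative (not even the trivial one) of the leader of another element, and the elements are
pairwise partially reduced. -/
structure IsDTriangular (C : Set (DiffPoly m n k)) : Prop where
  not_const : ∀ f ∈ C, ∀ c : k, f ≠ MvPolynomial.C c
  leaders : ∀ f ∈ C, ∀ g ∈ C, f ≠ g → ∀ u v, IsLeader u f → IsLeader v g → ¬ u.IsDerivOf v
  partially : ∀ f ∈ C, ∀ g ∈ C, f ≠ g → PartiallyReduced f g

/-- The set of all `θ f`, with `f ∈ C` and `θ` a derivative operator, such that
`θ (ld f)` is lower than `v`. -/
def prolongBelow (δ : Fin m → Derivation ℤ k k) (C : Set (DiffPoly m n k)) (v : Deriv m n) :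
    Set (DiffPoly m n k) :=
  {q | ∃ f ∈ C, ∃ u θ, IsLeader u f ∧ Deriv.shift θ u < v ∧ q = applyOp δ θ f}

/-- Coherence: whenever the leaders `u`, `w` of two distinct elements `f`, `g` of `C` have a
common derivative, with `v = θ u = θ' w` the lowest one, the polynomial `s_g (θ f) - s_f (θ' g)`
lies in `(ΘC_{<v}) : H_C^∞`. -/
def IsCoherent (δ : Fin m → Derivation ℤ k k) (C : Set (DiffPoly m n k)) : Prop :=
  ∀ f ∈ C, ∀ g ∈ C, f ≠ g → ∀ u w, IsLeader u f → IsLeader w g → u.var = w.var →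
    separantAt w g * applyOp δ (u.op ⊔ w.op - u.op) f -
        separantAt u f * applyOp δ (u.op ⊔ w.op - w.op) g ∈
      sat (Ideal.span (prolongBelow δ C ⟨u.op ⊔ w.op, u.var⟩)) (initSep C)

/-- `g` is a differential remainder of `f` with respect to `C`: it is reduced with respect to
every element of `C`, and `h f - g ∈ [C] : H_C^∞` for some `h ∈ H_C^∞`. -/
def IsDiffRemainder (δ : Fin m → Derivation ℤ k k) (C : Set (DiffPoly m n k))
    (f g : DiffPoly m n k) : Prop :=
  (∀ c ∈ C, Reduced g c) ∧
    ∃ h ∈ Submonoid.closure (initSep C), h * f - g ∈ sat (diffIdeal δ C) (initSep C)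

end Ranked

end DiffPoly

end

/-! Let `g`, `g'` be remainders of `f` with multipliers `h`, `h'`. Then `h g' - h' g` lies in `[C] :
H_C^∞`, and it contains no proper derivative of a leader, so Rosenfeld's lemma
(`mem_sat_span_of_mem_sat_diffIdeal`) puts it in `(C) : H_C^∞`. If `P` contains all derivatives
occurring in `C` and `g`, putting `0` for the derivatives outside `P` is a ring homomorphism that
fixes `C`, `h`, `h'` and `g`, hence preserves `(C) : H_C^∞`. Subtracting the image gives `h (g' -
g'_P)`, so `g' - g'_P` belongs to that ideal. Dropping terms keeps `g'` reduced. The three claims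
are the cases where `P` is the complement of `u`, the set `X`, and the derivatives of order at most
`p_i`.

Rosenfeld's lemma is a descent on the highest rank `v` of the prolongations used
(`mem_sat_prolong_Iio`). If `v = θ (ld c)` is a proper derivative, then `θ c = s_c v + t` with `t`
lower than `v`. Substituting `-t / s_c` for `v` kills `θ c`, and by coherence every other
prolongation of rank `v`, while elements free of `v` are unchanged. Rankings are well-orders, so the
descent ends at `(C)`. -/

namespace Deriv

variable {m n : ℕ}

theorem shift_zero (u : Deriv m n) : shift 0 u = u := by
  simp [shift]

theorem shift_shift (θ φ : Fin m →₀ ℕ) (u : Deriv m n) :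
    shift θ (shift φ u) = shift (θ + φ) u := by
  simp [shift, add_assoc]

theorem shift_injective (θ : Fin m →₀ ℕ) : Function.Injective (shift (n := n) θ) := by
  intro u v h
  simp only [shift, Deriv.mk.injEq, add_right_inj] at h
  exact Deriv.ext h.1 h.2

theorem shift_left_injective (u : Deriv m n) : Function.Injective fun θ => shift θ u := by
  intro θ φ h
  simpa [shift] using h

end Deriv

/-! ### Rankings -/

namespace IsRanking

variable {m n : ℕ} [LinearOrder (Deriv m n)]

theorem shift_lt_shift (hrank : IsRanking m n) (θ : Fin m →₀ ℕ) {u v : Deriv m n} (h : u < v) :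
    Deriv.shift θ u < Deriv.shift θ v :=
  (hrank.shift_mono θ v u h.le).lt_of_ne fun e => h.ne (Deriv.shift_injective θ e)

theorem lt_shift (hrank : IsRanking m n) {θ : Fin m →₀ ℕ} (hθ : θ ≠ 0) (u : Deriv m n) :
    u < Deriv.shift θ u := by
  refine (hrank.le_shift θ u).lt_of_ne fun e => hθ ?_
  exact Deriv.shift_left_injective u (e.symm.trans (Deriv.shift_zero u).symm)

/-- By Dickson's lemma, every ranking is a well-order. -/
theorem wellFoundedLT (hrank : IsRanking m n) : WellFoundedLT (Deriv m n) := by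
  have hwqo : WellQuasiOrdered fun a b : Fin n × (Fin m →₀ ℕ) => a.1 = b.1 ∧ a.2 ≤ b.2 :=
    (Finite.wellQuasiOrdered (· = ·)).prod wellQuasiOrdered_le
  rw [WellFoundedLT, isWellFounded_iff, RelEmbedding.wellFounded_iff_isEmpty]
  refine ⟨fun s => ?_⟩
  -- In a strictly decreasing sequence some later term would be a derivative of an earlier one,
  -- hence not lower.
  obtain ⟨i, j, hij, hvar, hop⟩ := hwqo fun i => ((s i).var, (s i).op)
  have hlt : s j < s i := s.map_rel_iff.2 hij
  have hshift : s j = Deriv.shift ((s j).op - (s i).op) (s i) := by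
    refine Deriv.ext ?_ hvar.symm
    exact (tsub_add_cancel_of_le hop).symm
  exact absurd (hrank.le_shift ((s j).op - (s i).op) (s i)) (not_le.2 (hshift ▸ hlt))

end IsRanking

/-- Builds a derivative operator one derivation at a time. -/
theorem Finsupp.induction_add_single_one {ι : Type*} {P : (ι →₀ ℕ) → Prop} (zero : P 0)
    (add_single : ∀ θ j, P θ → P (θ + Finsupp.single j 1)) (θ : ι →₀ ℕ) : P θ := by
  classical
  refine Finsupp.induction₂ θ zero fun a b f _ _ hf => ?_
  clear * - hf add_single
  induction b with
  | zero => simpa using hf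
  | succ b ih => rw [Finsupp.single_add, ← add_assoc]; exact add_single _ _ ih

namespace DiffPoly

/-! ### Derivative operators and the leaders of `θ f` -/

section Derivations

variable {m n : ℕ} {k : Type*} [Field k] (δ : Fin m → Derivation ℤ k k)

theorem mapCoeff_C (d : Derivation ℤ k k) (a : k) :
    mapCoeff d (C a : DiffPoly m n k) = C (d a) := by
  classical
  ext s
  rw [coeff_mapCoeff, coeff_C, coeff_C]
  split_ifs <;> simp

theorem mapCoeff_X (d : Derivation ℤ k k) (u : Deriv m n) :
    mapCoeff d (X u : DiffPoly m n k) = 0 := by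
  classical
  ext s
  rw [coeff_mapCoeff, coeff_X, coeff_zero]
  split_ifs <;> simp

theorem deriv_C (j : Fin m) (a : k) : deriv δ j (C a : DiffPoly m n k) = C (δ j a) := by
  change mapCoeff (δ j) (C a) + mkDerivation k _ (C a) = _
  rw [mapCoeff_C, derivation_C, add_zero]

theorem deriv_X (j : Fin m) (u : Deriv m n) :
    deriv δ j (X u : DiffPoly m n k) = X (Deriv.shift (Finsupp.single j 1) u) := by
  change mapCoeff (δ j) (X u) + mkDerivation k _ (X u) = _
  rw [mapCoeff_X, mkDerivation_X, zero_add]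

theorem deriv_mul (j : Fin m) (f g : DiffPoly m n k) :
    deriv δ j (f * g) = f * deriv δ j g + g * deriv δ j f := by
  simp

theorem deriv_comm (hδ : ∀ i j a, δ i (δ j a) = δ j (δ i a)) (i j : Fin m)
    (f : DiffPoly m n k) : deriv δ i (deriv δ j f) = deriv δ j (deriv δ i f) := by
  induction f using MvPolynomial.induction_on with
  | C a => simp only [deriv_C, hδ i j]
  | add f g hf hg => simp only [map_add, hf, hg]
  | mul_X f u hf =>
    simp only [deriv_mul, deriv_X, map_add, hf, Deriv.shift_shift,
      add_comm (Finsupp.single i 1)]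
    ring

theorem applyOp_zero (f : DiffPoly m n k) : applyOp δ 0 f = f := by
  unfold applyOp
  induction List.finRange m with
  | nil => rfl
  | cons a l ih => simp

/-- `applyOp` composes the derivations in a fixed order, so the extra `δ_j` appears inside the fold;
commutativity moves it outermost. -/
theorem applyOp_add_single (hδ : ∀ i j a, δ i (δ j a) = δ j (δ i a)) (θ : Fin m →₀ ℕ)
    (j : Fin m) (f : DiffPoly m n k) :
    applyOp δ (θ + Finsupp.single j 1) f = deriv δ j (applyOp δ θ f) := by
  have key : ∀ l : List (Fin m), l.Nodup →
      l.foldr (fun i g => (deriv δ i)^[(θ + Finsupp.single j 1 : Fin m →₀ ℕ) i] g) f =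
        if j ∈ l then deriv δ j (l.foldr (fun i g => (deriv δ i)^[θ i] g) f)
        else l.foldr (fun i g => (deriv δ i)^[θ i] g) f := by
    intro l
    induction l with
    | nil => simp
    | cons a l ih =>
      intro hl
      rw [List.nodup_cons] at hl
      have ih := ih hl.2
      simp only [List.foldr_cons]
      rw [ih]
      by_cases haj : a = j
      · subst haj
        simp [hl.1, Function.iterate_succ_apply']
      · have hja : j ≠ a := fun h => haj h.symm
        by_cases hjl : j ∈ l
        · have hcomm : Function.Commute (deriv (n := n) δ a) (deriv δ j) :=
            fun g => deriv_comm δ hδ a j g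
          simp only [Finsupp.add_apply, Finsupp.single_apply, hja, if_false, add_zero, hjl,
            if_true, List.mem_cons, or_true]
          exact (hcomm.iterate_left _) _
        · simp [hja, hjl]
  have := key (List.finRange m) (List.nodup_finRange m)
  rwa [if_pos (List.mem_finRange j)] at this

/-- The derivation `δ_j` maps `k[S]` to `k[T]` whenever `T` contains `S` and `δ_j S`. -/
theorem deriv_mem_supported (j : Fin m) {S T : Set (Deriv m n)} (hST : S ⊆ T)
    (hshift : ∀ u ∈ S, Deriv.shift (Finsupp.single j 1) u ∈ T) {f : DiffPoly m n k}
    (hf : f ∈ supported k S) : deriv δ j f ∈ supported k T := by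
  have hle : supported k S ≤ supported k T := supported_mono hST
  induction hf using Algebra.adjoin_induction with
  | mem x hx =>
    obtain ⟨u, hu, rfl⟩ := hx
    rw [deriv_X]
    exact X_mem_supported.2 (hshift u hu)
  | algebraMap r =>
    rw [algebraMap_eq, deriv_C, ← algebraMap_eq]
    exact Subalgebra.algebraMap_mem _ _
  | add x y _ _ hx hy => rw [map_add]; exact add_mem hx hy
  | mul x y hx' hy' hx hy =>
    rw [deriv_mul]
    exact add_mem (mul_mem (hle hx') hy) (mul_mem (hle hy') hx)

theorem pderiv_mem_supported (u : Deriv m n) {S : Set (Deriv m n)} {f : DiffPoly m n k}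
    (hf : f ∈ supported k S) : pderiv u f ∈ supported k S := by
  classical
  induction hf using Algebra.adjoin_induction with
  | mem x hx =>
    obtain ⟨w, hw, rfl⟩ := hx
    rw [pderiv_X, Pi.single_apply]
    split_ifs
    exacts [one_mem _, zero_mem _]
  | algebraMap r => rw [algebraMap_eq, pderiv_C]; exact zero_mem _
  | add x y _ _ hx hy => rw [map_add]; exact add_mem hx hy
  | mul x y hx' hy' hx hy =>
    rw [Derivation.leibniz, smul_eq_mul, smul_eq_mul]
    exact add_mem (mul_mem hx' hy) (mul_mem hy' hx)

theorem coeffIn_mem_supported (u : Deriv m n) (d : ℕ) {S : Set (Deriv m n)}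
    {f : DiffPoly m n k} (hf : f ∈ supported k S) : coeffIn u d f ∈ supported k S := by
  classical
  refine sum_mem fun s hs => ?_
  rw [mem_supported]
  intro w hw
  rw [vars_monomial (mem_support_iff.1 (Finset.mem_filter.1 hs).1), Finsupp.support_erase] at hw
  refine mem_supported.1 hf ?_
  exact (mem_vars_iff_mem_support w).2 ⟨s, (Finset.mem_filter.1 hs).1, Finset.mem_of_mem_erase hw⟩

variable [LinearOrder (Deriv m n)]

theorem IsLeader.mem_supported_Iic {u : Deriv m n} {f : DiffPoly m n k} (h : IsLeader u f) :
    f ∈ supported k (Set.Iic u) :=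
  mem_supported.2 fun w hw => h.2 w hw

theorem IsLeader.unique {u w : Deriv m n} {f : DiffPoly m n k} (hu : IsLeader u f)
    (hw : IsLeader w f) : u = w :=
  le_antisymm (hw.2 u hu.1) (hu.2 w hw.1)

/-- Chain rule: only the variable `u` contributes `δ_j u`, since `w < u` gives `δ_j w < δ_j u`. The
difference is itself a derivation in `f`, so generators and products suffice. -/
theorem deriv_sub_mem_supported (hrank : IsRanking m n) (j : Fin m) {u : Deriv m n}
    {f : DiffPoly m n k} (hf : f ∈ supported k (Set.Iic u)) :
    deriv δ j f - pderiv u f * X (Deriv.shift (Finsupp.single j 1) u) ∈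
      supported k (Set.Iio (Deriv.shift (Finsupp.single j 1) u)) := by
  classical
  have hlt : u < Deriv.shift (Finsupp.single j 1) u := hrank.lt_shift (by simp) u
  have hle : supported k (Set.Iic u) ≤
      supported k (Set.Iio (Deriv.shift (Finsupp.single j 1) u)) :=
    supported_mono fun w hw => lt_of_le_of_lt hw hlt
  induction hf using Algebra.adjoin_induction with
  | mem x hx =>
    obtain ⟨w, hw, rfl⟩ := hx
    rw [deriv_X, pderiv_X]
    rcases (show w ≤ u from hw).eq_or_lt with rfl | hwu
    · simp
    · rw [Pi.single_eq_of_ne hwu.ne, zero_mul, sub_zero]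
      exact X_mem_supported.2 (hrank.shift_lt_shift _ hwu)
  | algebraMap r =>
    rw [algebraMap_eq, deriv_C, pderiv_C, zero_mul, sub_zero, ← algebraMap_eq]
    exact Subalgebra.algebraMap_mem _ _
  | add x y _ _ hx hy =>
    rw [map_add, map_add, add_mul, add_sub_add_comm]
    exact add_mem hx hy
  | mul x y hx' hy' hx hy =>
    rw [deriv_mul, Derivation.leibniz, smul_eq_mul, smul_eq_mul]
    convert add_mem (mul_mem (hle hx') hy) (mul_mem (hle hy') hx) using 1
    ring

/-- A proper derivative `θ f` is linear in its leader, with the separant of `f` as leading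
coefficient. -/
theorem applyOp_sub_mem_supported (hδ : ∀ i j a, δ i (δ j a) = δ j (δ i a))
    (hrank : IsRanking m n) {u : Deriv m n} {f : DiffPoly m n k} (hf : IsLeader u f)
    (θ : Fin m →₀ ℕ) (hθ : θ ≠ 0) :
    applyOp δ θ f - separantAt u f * X (Deriv.shift θ u) ∈
      supported k (Set.Iio (Deriv.shift θ u)) := by
  induction θ using Finsupp.induction_add_single_one with
  | zero => exact absurd rfl hθ
  | add_single θ j ih =>
    rw [applyOp_add_single δ hδ]
    -- The induction really starts at a single derivation: `f` itself need not be linear in its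
    -- leader.
    by_cases h0 : θ = 0
    · subst h0
      rw [applyOp_zero, zero_add]
      exact deriv_sub_mem_supported δ hrank j hf.mem_supported_Iic
    · have hlt : ∀ w : Deriv m n, w < Deriv.shift (Finsupp.single j 1) w :=
        hrank.lt_shift (by simp)
      have hu := hrank.lt_shift h0 u
      rw [add_comm, ← Deriv.shift_shift]
      set v := Deriv.shift θ u
      have h1 := deriv_mem_supported δ j (T := Set.Iio (Deriv.shift (Finsupp.single j 1) v))
        (fun w hw => lt_trans hw (hlt v)) (fun w hw => hrank.shift_lt_shift _ hw) (ih h0)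
      have h2 := deriv_mem_supported δ j (T := Set.Iio (Deriv.shift (Finsupp.single j 1) v))
        (fun w hw => (lt_of_le_of_lt hw hu).trans (hlt v))
        (fun w hw => hrank.shift_lt_shift _ (lt_of_le_of_lt hw hu))
        (pderiv_mem_supported u hf.mem_supported_Iic)
      have h3 : (X v : DiffPoly m n k) ∈
          supported k (Set.Iio (Deriv.shift (Finsupp.single j 1) v)) :=
        X_mem_supported.2 (hlt v)
      -- The separant involves only derivatives up to `u < v`, so after differentiation `δ_j v`
      -- occurs only in `s_f * δ_j v`.
      have hdec : deriv δ j (applyOp δ θ f) -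
          separantAt u f * X (Deriv.shift (Finsupp.single j 1) v) =
          deriv δ j (applyOp δ θ f - separantAt u f * X v) + deriv δ j (pderiv u f) * X v := by
        rw [map_sub, deriv_mul, deriv_X, separantAt]
        ring
      rw [hdec]
      exact add_mem h1 (mul_mem h2 h3)

theorem applyOp_mem_supported (hδ : ∀ i j a, δ i (δ j a) = δ j (δ i a))
    (hrank : IsRanking m n) {u : Deriv m n} {f : DiffPoly m n k} (hf : IsLeader u f)
    (θ : Fin m →₀ ℕ) : applyOp δ θ f ∈ supported k (Set.Iic (Deriv.shift θ u)) := by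
  induction θ using Finsupp.induction_add_single_one with
  | zero =>
    rw [applyOp_zero, Deriv.shift_zero]
    exact hf.mem_supported_Iic
  | add_single θ j ih =>
    rw [applyOp_add_single δ hδ, add_comm, ← Deriv.shift_shift]
    exact deriv_mem_supported δ j (Set.Iic_subset_Iic.2 (hrank.le_shift _ _))
      (fun w hw => hrank.shift_mono _ (Deriv.shift θ u) w hw) ih

end Derivations

end DiffPoly

universe u

namespace DiffPoly

/-! ### Saturated ideals -/

section Saturation

variable {R : Type*} [CommRing R]

theorem le_sat (I : Ideal R) (S : Set R) : I ≤ sat I S :=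
  fun a ha => ⟨1, one_mem _, by rwa [one_mul]⟩

theorem sat_mono {I J : Ideal R} (h : I ≤ J) (S : Set R) : sat I S ≤ sat J S :=
  fun _ ⟨s, hs, ha⟩ => ⟨s, hs, h ha⟩

theorem mem_sat_of_mul_mem {I : Ideal R} {S : Set R} {s a : R} (hs : s ∈ Submonoid.closure S)
    (h : s * a ∈ sat I S) : a ∈ sat I S := by
  obtain ⟨t, ht, hta⟩ := h
  exact ⟨t * s, mul_mem ht hs, by rwa [mul_assoc]⟩

/-- `I : S^∞` is the kernel of the canonical map to the quotient by `I` of the localization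
at `S`. -/
theorem exists_ringHom_ker_eq_sat {R : Type u} [CommRing R] (I : Ideal R) (S : Set R) :
    ∃ (Q : Type u) (_ : CommRing Q) (π : R →+* Q),
      (∀ s ∈ Submonoid.closure S, IsUnit (π s)) ∧ ∀ a, π a = 0 ↔ a ∈ sat I S := by
  let L := Localization (Submonoid.closure S)
  let K : Ideal L := I.map (algebraMap R L)
  refine ⟨L ⧸ K, inferInstance, (Ideal.Quotient.mk K).comp (algebraMap R L), ?_, ?_⟩
  · intro s hs
    exact (IsLocalization.map_units L (⟨s, hs⟩ : Submonoid.closure S)).map (Ideal.Quotient.mk K)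
  · intro a
    rw [RingHom.comp_apply, Ideal.Quotient.eq_zero_iff_mem,
      IsLocalization.algebraMap_mem_map_algebraMap_iff (Submonoid.closure S)]
    rfl

variable {m n : ℕ} {k : Type*} [Field k] {δ : Fin m → Derivation ℤ k k}

/-- Rests on `s² δa = s δ(sa) - δ(s) sa`. The target `J` may be larger than `I` because
differentiation raises the rank of prolongations. -/
theorem deriv_mem_sat (j : Fin m) {I J : Ideal (DiffPoly m n k)} (hIJ : I ≤ J)
    (hD : ∀ x ∈ I, deriv δ j x ∈ J) {S : Set (DiffPoly m n k)} {a : DiffPoly m n k}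
    (ha : a ∈ sat I S) : deriv δ j a ∈ sat J S := by
  obtain ⟨s, hs, hsa⟩ := ha
  refine ⟨s * s, mul_mem hs hs, ?_⟩
  have h : s * s * deriv δ j a = s * deriv δ j (s * a) - deriv δ j s * (s * a) := by
    rw [deriv_mul]
    ring
  rw [h]
  exact J.sub_mem (J.mul_mem_left _ (hD _ hsa)) (J.mul_mem_left _ (hIJ hsa))

theorem deriv_mem_of_mem_span (j : Fin m) {G : Set (DiffPoly m n k)}
    {J : Ideal (DiffPoly m n k)} (hG : G ⊆ J) (hD : ∀ q ∈ G, deriv δ j q ∈ J)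
    {a : DiffPoly m n k} (ha : a ∈ Ideal.span G) : deriv δ j a ∈ J := by
  induction ha using Submodule.span_induction with
  | mem x hx => exact hD x hx
  | zero => rw [map_zero]; exact J.zero_mem
  | add x y _ _ hx hy => rw [map_add]; exact J.add_mem hx hy
  | smul r x hx' hx =>
    rw [smul_eq_mul, deriv_mul]
    exact J.add_mem (J.mul_mem_left _ hx) (J.mul_mem_right _ (Ideal.span_le.2 hG hx'))

theorem span_le_diffIdeal {C : Set (DiffPoly m n k)} : Ideal.span C ≤ diffIdeal δ C :=
  le_sInf fun _ hI => Ideal.span_le.2 hI.1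

end Saturation

/-! ### Coherence and Rosenfeld's lemma -/

section Rosenfeld

variable {m n : ℕ} {k : Type*} [Field k] [LinearOrder (Deriv m n)]

/-- The set of all `θ f`, with `f ∈ C` and `θ` a derivative operator, such that
`θ (ld f)` belongs to `S`. -/
def prolong (δ : Fin m → Derivation ℤ k k) (C : Set (DiffPoly m n k)) (S : Set (Deriv m n)) :
    Set (DiffPoly m n k) :=
  {q | ∃ f ∈ C, ∃ u θ, IsLeader u f ∧ Deriv.shift θ u ∈ S ∧ q = applyOp δ θ f}

/-- The derivatives that are not proper derivatives of a leader of an element of `C`. -/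
def partiallyReducedVars (C : Set (DiffPoly m n k)) : Set (Deriv m n) :=
  {w | ∀ c ∈ C, ∀ u, IsLeader u c → ¬ w.IsProperDerivOf u}

variable {δ : Fin m → Derivation ℤ k k} {C : Set (DiffPoly m n k)}

theorem prolong_mono {S T : Set (Deriv m n)} (h : S ⊆ T) : prolong δ C S ⊆ prolong δ C T :=
  fun _ ⟨f, hf, u, θ, hu, hS, hq⟩ => ⟨f, hf, u, θ, hu, h hS, hq⟩

theorem IsDTriangular.exists_isLeader (hC : IsDTriangular C) {f : DiffPoly m n k} (hf : f ∈ C) :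
    ∃ u, IsLeader u f := by
  have hne : f.vars.Nonempty := by
    rw [Finset.nonempty_iff_ne_empty]
    intro h
    exact hC.not_const f hf _ (vars_eq_empty_iff_eq_C.1 h)
  exact ⟨f.vars.max' hne, Finset.max'_mem _ _, fun v hv => Finset.le_max' _ v hv⟩

theorem separantAt_mem_initSep {u : Deriv m n} {f : DiffPoly m n k} (hf : f ∈ C)
    (hu : IsLeader u f) : separantAt u f ∈ Submonoid.closure (initSep C) :=
  Submonoid.subset_closure ⟨f, hf, u, hu, Or.inr rfl⟩

theorem closure_initSep_subset_supported {S : Set (Deriv m n)}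
    (hS : ∀ f ∈ C, f ∈ supported k S) {h : DiffPoly m n k}
    (hh : h ∈ Submonoid.closure (initSep C)) : h ∈ supported k S := by
  have hle : Submonoid.closure (initSep C) ≤ (supported k S).toSubmonoid := by
    rw [Submonoid.closure_le]
    rintro _ ⟨f, hf, u, -, rfl | rfl⟩
    · exact coeffIn_mem_supported _ _ (hS f hf)
    · exact pderiv_mem_supported _ (hS f hf)
  exact hle hh

/-- For the element's own leader the ranking suffices: a proper derivative would outrank it.
Consequently `C` and `H_C` are untouched when a proper derivative of a leader is substituted. -/
theorem IsDTriangular.mem_supported_partiallyReducedVars (hrank : IsRanking m n)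
    (hC : IsDTriangular C) {f : DiffPoly m n k} (hf : f ∈ C) :
    f ∈ supported k (partiallyReducedVars C) := by
  rw [mem_supported]
  intro w hw c hc u hu
  by_cases hfc : f = c
  · subst hfc
    rintro ⟨θ, hθ, rfl⟩
    exact not_le.2 (hrank.lt_shift hθ u) (hu.2 _ hw)
  · exact hC.partially f hf c hc hfc u hu w hw

theorem diffIdeal_le_span_prolong (hδ : ∀ i j a, δ i (δ j a) = δ j (δ i a))
    (hC : IsDTriangular C) : diffIdeal δ C ≤ Ideal.span (prolong δ C Set.univ) := by
  refine sInf_le ⟨fun f hf => ?_, fun j f hf => ?_⟩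
  · obtain ⟨u, hu⟩ := hC.exists_isLeader hf
    exact Ideal.subset_span ⟨f, hf, u, 0, hu, trivial, (applyOp_zero δ f).symm⟩
  · refine deriv_mem_of_mem_span j Ideal.subset_span ?_ hf
    rintro _ ⟨c, hc, u, θ, hu, -, rfl⟩
    rw [← applyOp_add_single δ hδ]
    exact Ideal.subset_span ⟨c, hc, u, _, hu, trivial, rfl⟩

theorem deriv_mem_sat_prolong (hδ : ∀ i j a, δ i (δ j a) = δ j (δ i a))
    (hrank : IsRanking m n) (j : Fin m) {v : Deriv m n} {H : Set (DiffPoly m n k)}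
    {a : DiffPoly m n k} (ha : a ∈ sat (Ideal.span (prolong δ C (Set.Iio v))) H) :
    deriv δ j a ∈
      sat (Ideal.span (prolong δ C (Set.Iio (Deriv.shift (Finsupp.single j 1) v)))) H := by
  have hsub : prolong δ C (Set.Iio v) ⊆
      prolong δ C (Set.Iio (Deriv.shift (Finsupp.single j 1) v)) :=
    prolong_mono (Set.Iio_subset_Iio (hrank.le_shift _ _))
  refine deriv_mem_sat j (Ideal.span_mono hsub) (fun x hx => ?_) ha
  refine deriv_mem_of_mem_span j (hsub.trans Ideal.subset_span) ?_ hx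
  rintro _ ⟨c, hc, u, θ, hu, hlt, rfl⟩
  rw [← applyOp_add_single δ hδ]
  refine Ideal.subset_span ⟨c, hc, u, _, hu, ?_, rfl⟩
  rw [add_comm, ← Deriv.shift_shift]
  exact hrank.shift_lt_shift _ hlt

/-- In a coherent set, the coherence condition holds at every common derivative of two leaders,
not only at the lowest one. -/
theorem IsCoherent.sub_mem_sat (hδ : ∀ i j a, δ i (δ j a) = δ j (δ i a))
    (hrank : IsRanking m n) (hcoh : IsCoherent δ C) {f g : DiffPoly m n k} (hf : f ∈ C)
    (hg : g ∈ C) {u w : Deriv m n} (hu : IsLeader u f) (hw : IsLeader w g)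
    {θ φ : Fin m →₀ ℕ} (h : Deriv.shift θ u = Deriv.shift φ w) :
    separantAt w g * applyOp δ θ f - separantAt u f * applyOp δ φ g ∈
      sat (Ideal.span (prolong δ C (Set.Iio (Deriv.shift θ u)))) (initSep C) := by
  by_cases hfg : f = g
  · subst hfg
    obtain rfl := hu.unique hw
    obtain rfl := Deriv.shift_left_injective u h
    rw [sub_self]
    exact zero_mem _
  have hvar : u.var = w.var := (Deriv.ext_iff.1 h).2
  have hop : θ + u.op = φ + w.op := (Deriv.ext_iff.1 h).1
  -- Every common derivative is some `ψ` applied to the lowest one; the proof is by induction on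
  -- `ψ`.
  have key : ∀ ψ : Fin m →₀ ℕ,
      separantAt w g * applyOp δ (ψ + (u.op ⊔ w.op - u.op)) f -
        separantAt u f * applyOp δ (ψ + (u.op ⊔ w.op - w.op)) g ∈
      sat (Ideal.span (prolong δ C (Set.Iio (Deriv.shift ψ ⟨u.op ⊔ w.op, u.var⟩))))
        (initSep C) := by
    intro ψ
    induction ψ using Finsupp.induction_add_single_one with
    | zero =>
      rw [zero_add, zero_add, Deriv.shift_zero]
      exact hcoh f hf g hg hfg u w hu hw hvar
    | add_single ψ j ih =>
      have h1 := deriv_mem_sat_prolong hδ hrank j ih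
      rw [add_right_comm ψ _ (u.op ⊔ w.op - u.op), add_right_comm ψ _ (u.op ⊔ w.op - w.op),
        applyOp_add_single δ hδ, applyOp_add_single δ hδ, add_comm ψ (Finsupp.single j 1), ← Deriv.shift_shift]
      set v := Deriv.shift ψ ⟨u.op ⊔ w.op, u.var⟩ with hv
      have hlt : v < Deriv.shift (Finsupp.single j 1) v := hrank.lt_shift (by simp) v
      have hvf : Deriv.shift (ψ + (u.op ⊔ w.op - u.op)) u = v := by
        rw [← Deriv.shift_shift, hv]
        congr 1
        exact Deriv.ext (tsub_add_cancel_of_le le_sup_left) rfl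
      have hvg : Deriv.shift (ψ + (u.op ⊔ w.op - w.op)) w = v := by
        rw [← Deriv.shift_shift, hv]
        congr 1
        exact Deriv.ext (tsub_add_cancel_of_le le_sup_right) hvar.symm
      set J := sat (Ideal.span (prolong δ C (Set.Iio (Deriv.shift (Finsupp.single j 1) v))))
        (initSep C)
      have h2 : applyOp δ (ψ + (u.op ⊔ w.op - u.op)) f ∈ J :=
        le_sat _ _ (Ideal.subset_span ⟨f, hf, u, _, hu, hvf ▸ hlt, rfl⟩)
      have h3 : applyOp δ (ψ + (u.op ⊔ w.op - w.op)) g ∈ J :=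
        le_sat _ _ (Ideal.subset_span ⟨g, hg, w, _, hw, hvg ▸ hlt, rfl⟩)
      -- The product rule leaves error terms with the factors `δ_j s_g` and `δ_j s_f`; they multiply
      -- prolongations of rank `v < δ_j v`, so they lie in `J`.
      have h4 := J.sub_mem h1 (J.sub_mem (J.mul_mem_right (deriv δ j (separantAt w g)) h2)
        (J.mul_mem_right (deriv δ j (separantAt u f)) h3))
      convert h4 using 1
      rw [map_sub, deriv_mul, deriv_mul]
      ring
  have hle : u.op ⊔ w.op ≤ θ + u.op :=
    sup_le le_add_self (hop ▸ le_add_self)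
  have hψ := tsub_add_cancel_of_le hle
  have hθ : θ + u.op - u.op ⊔ w.op + (u.op ⊔ w.op - u.op) = θ := by
    refine add_right_cancel (b := u.op) ?_
    rw [add_assoc, tsub_add_cancel_of_le le_sup_left, hψ]
  have hφ : θ + u.op - u.op ⊔ w.op + (u.op ⊔ w.op - w.op) = φ := by
    refine add_right_cancel (b := w.op) ?_
    rw [add_assoc, tsub_add_cancel_of_le le_sup_right, hψ, hop]
  have hv : Deriv.shift (θ + u.op - u.op ⊔ w.op) ⟨u.op ⊔ w.op, u.var⟩ = Deriv.shift θ u :=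
    Deriv.ext hψ rfl
  have := key (θ + u.op - u.op ⊔ w.op)
  rwa [hθ, hφ, hv] at this

/-- An element of the ideal generated by `C` and `prolong δ C S` already belongs to the ideal
generated by `C` and the elements up to some rank in `S`. -/
theorem exists_mem_sat_prolong_Iic {S : Set (Deriv m n)} {H : Set (DiffPoly m n k)}
    {p : DiffPoly m n k} (hp : p ∈ sat (Ideal.span (C ∪ prolong δ C S)) H) :
    p ∈ sat (Ideal.span C) H ∨
      ∃ w ∈ S, p ∈ sat (Ideal.span (C ∪ prolong δ C (Set.Iic w))) H := by
  obtain ⟨s, hs, hsp⟩ := hp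
  have hmono : ∀ {v w : Deriv m n}, v ≤ w → Ideal.span (C ∪ prolong δ C (Set.Iic v)) ≤
      Ideal.span (C ∪ prolong δ C (Set.Iic w)) := fun hvw =>
    Ideal.span_mono (Set.union_subset_union_right _ (prolong_mono (Set.Iic_subset_Iic.2 hvw)))
  have hC : ∀ w : Deriv m n, Ideal.span C ≤ Ideal.span (C ∪ prolong δ C (Set.Iic w)) :=
    fun w => Ideal.span_mono Set.subset_union_left
  suffices hs : s * p ∈ Ideal.span C ∨
      ∃ w ∈ S, s * p ∈ Ideal.span (C ∪ prolong δ C (Set.Iic w)) by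
    rcases hs with h | ⟨w, hw, h⟩
    exacts [Or.inl ⟨s, ‹_›, h⟩, Or.inr ⟨w, hw, s, ‹_›, h⟩]
  generalize s * p = x at hsp ⊢
  induction hsp using Submodule.span_induction with
  | mem x hx =>
    rcases hx with hx | ⟨f, hf, u, θ, hu, hS, rfl⟩
    · exact Or.inl (Ideal.subset_span hx)
    · exact Or.inr ⟨_, hS, Ideal.subset_span (Or.inr ⟨f, hf, u, θ, hu, Set.self_mem_Iic, rfl⟩)⟩
  | zero => exact Or.inl (zero_mem _)
  | add x y _ _ hx hy =>
    -- The larger of the two ranks bounds both summands.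
    rcases hx with hx | ⟨v, hv, hx⟩ <;> rcases hy with hy | ⟨w, hw, hy⟩
    · exact Or.inl (add_mem hx hy)
    · exact Or.inr ⟨w, hw, add_mem (hC w hx) hy⟩
    · exact Or.inr ⟨v, hv, add_mem hx (hC v hy)⟩
    · rcases le_total v w with h | h
      · exact Or.inr ⟨w, hw, add_mem (hmono h hx) hy⟩
      · exact Or.inr ⟨v, hv, add_mem hx (hmono h hy)⟩
  | smul r x _ hx =>
    rcases hx with hx | ⟨v, hv, hx⟩
    · exact Or.inl (Submodule.smul_mem _ _ hx)
    · exact Or.inr ⟨v, hv, Submodule.smul_mem _ _ hx⟩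

/-- A proper derivative `v` of a leader can be eliminated: a polynomial free of proper
derivatives of leaders that belongs to the saturated ideal of the prolongations up to `v`
belongs to the one of the prolongations below `v`. -/
theorem mem_sat_prolong_Iio (hδ : ∀ i j a, δ i (δ j a) = δ j (δ i a))
    (hrank : IsRanking m n) (hC : IsDTriangular C) (hcoh : IsCoherent δ C) {v : Deriv m n}
    {p : DiffPoly m n k} (hp : p ∈ supported k (partiallyReducedVars C))
    (h : p ∈ sat (Ideal.span (C ∪ prolong δ C (Set.Iic v))) (initSep C)) :
    p ∈ sat (Ideal.span (C ∪ prolong δ C (Set.Iio v))) (initSep C) := by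
  classical
  by_cases hv : v ∈ partiallyReducedVars C
  · refine sat_mono (Ideal.span_le.2 ?_) _ h
    rintro _ (hx | ⟨f, hf, u, θ, hu, hle, rfl⟩)
    · exact Ideal.subset_span (Or.inl hx)
    rcases (show Deriv.shift θ u ≤ v from hle).lt_or_eq with hlt | rfl
    · exact Ideal.subset_span (Or.inr ⟨f, hf, u, θ, hu, hlt, rfl⟩)
    -- A prolongation of rank `v` is here an element of `C`, which is why `C` is kept among the
    -- generators.
    · have hθ : θ = 0 := by
        by_contra hθ
        exact hv f hf u hu ⟨θ, hθ, rfl⟩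
      rw [hθ, applyOp_zero]
      exact Ideal.subset_span (Or.inl hf)
  · obtain ⟨c, hc, u, hu, θ, hθ, rfl⟩ : ∃ c ∈ C, ∃ u, IsLeader u c ∧ v.IsProperDerivOf u := by
      simpa [partiallyReducedVars] using hv
    set v := Deriv.shift θ u
    have hNv : supported k (partiallyReducedVars C) ≤ supported k {v}ᶜ :=
      supported_mono (Set.subset_compl_singleton_iff.2 hv)
    have hIio : supported k (Set.Iio v) ≤ supported k ({v}ᶜ : Set (Deriv m n)) :=
      supported_mono fun w hw => ne_of_lt hw
    have hCv : ∀ f ∈ C, f ∈ supported k {v}ᶜ := fun f hf =>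
      hNv (hC.mem_supported_partiallyReducedVars hrank hf)
    have hHv : ∀ s ∈ Submonoid.closure (initSep C), s ∈ supported k {v}ᶜ := fun s hs =>
      closure_initSep_subset_supported hCv hs
    obtain ⟨Q, _, π, hunit, hker⟩ := exists_ringHom_ker_eq_sat
      (Ideal.span (C ∪ prolong δ C (Set.Iio v))) (initSep C)
    have hker' : ∀ q ∈ Ideal.span (C ∪ prolong δ C (Set.Iio v)), π q = 0 := fun q hq =>
      (hker q).2 (le_sat _ _ hq)
    -- With `t` the part of `θ c` below `v`, `y` is `-t / s_c` computed in `Q`, where separants are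
    -- units.
    obtain ⟨y, hy⟩ : π (separantAt u c) ∣ -π (applyOp δ θ c - separantAt u c * X v) :=
      (hunit _ (separantAt_mem_initSep hc hu)).dvd
    -- `ψ` differs from `π` only in its value at `v`, chosen so that `θ c` maps to `0`.
    let ψ : DiffPoly m n k →+* Q :=
      eval₂Hom (π.comp MvPolynomial.C) fun w => if w = v then y else π (X w)
    have hψv : ψ (X v) = y := by simp [ψ]
    have hψ : ∀ q ∈ supported k {v}ᶜ, ψ q = π q := by
      intro q hq
      induction hq using Algebra.adjoin_induction with
      | mem x hx =>
        obtain ⟨w, hw, rfl⟩ := hx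
        have hw : w ≠ v := hw
        simp [ψ, hw]
      | algebraMap r => simp [ψ]
      | add x y _ _ hx hy => rw [map_add, map_add, hx, hy]
      | mul x y _ _ hx hy => rw [map_mul, map_mul, hx, hy]
    have hψc : ψ (applyOp δ θ c) = 0 := by
      have ht := hψ _ (hIio (applyOp_sub_mem_supported δ hδ hrank hu θ hθ))
      rw [map_sub, map_mul, hψv, hψ _ (hHv _ (separantAt_mem_initSep hc hu)), ← hy, sub_neg_eq_add] at ht
      exact add_eq_right.1 ht
    have hψIio : ∀ q ∈ prolong δ C (Set.Iio v), ψ q = 0 := by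
      intro q hq
      rw [hψ, hker' q (Ideal.subset_span (Or.inr hq))]
      obtain ⟨f, hf, w, φ, hw, hlt, rfl⟩ := hq
      refine supported_mono ?_ (applyOp_mem_supported δ hδ hrank hw φ)
      exact fun x hx => ne_of_lt (lt_of_le_of_lt hx hlt)
    have hψIic : ∀ q ∈ C ∪ prolong δ C (Set.Iic v), ψ q = 0 := by
      rintro q (hq | ⟨f, hf, w, φ, hw, hle, rfl⟩)
      · rw [hψ q (hCv q hq), hker' q (Ideal.subset_span (Or.inl hq))]
      rcases (show Deriv.shift φ w ≤ v from hle).lt_or_eq with hlt | heq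
      · exact hψIio _ ⟨f, hf, w, φ, hw, hlt, rfl⟩
      -- Coherence relates `s_c (φ f)` to `s_f (θ c)` modulo prolongations below `v`. As `ψ` kills
      -- those and `θ c`, and `s_c` maps to a unit, it kills `φ f`.
      obtain ⟨s, hs, hmem⟩ := hcoh.sub_mem_sat hδ hrank hf hc hw hu heq
      rw [heq] at hmem
      have hspan : Ideal.span (prolong δ C (Set.Iio v)) ≤ RingHom.ker ψ :=
        Ideal.span_le.2 fun q hq => hψIio q hq
      have h0 : ψ (s * (separantAt u c * applyOp δ φ f - separantAt w f * applyOp δ θ c)) = 0 :=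
        hspan hmem
      have hsc := separantAt_mem_initSep hc hu
      rw [map_mul, map_sub, map_mul, map_mul, hψc, mul_zero, sub_zero, hψ s (hHv s hs),
        hψ _ (hHv _ hsc), (hunit s hs).mul_right_eq_zero, (hunit _ hsc).mul_right_eq_zero] at h0
      exact h0
    have hle : Ideal.span (C ∪ prolong δ C (Set.Iic v)) ≤ RingHom.ker ψ :=
      Ideal.span_le.2 fun q hq => hψIic q hq
    obtain ⟨s, hs, hsp⟩ := h
    have h0 : ψ (s * p) = 0 := hle hsp
    -- `p` is free of `v`, so the vanishing of `ψ p` is that of `π p`.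
    rw [map_mul, hψ s (hHv s hs), hψ p (hNv hp), (hunit s hs).mul_right_eq_zero] at h0
    exact (hker p).1 h0

/-- **Rosenfeld's lemma**: a partially reduced polynomial in `[C] : H_C^∞`, where `C` is a
coherent d-triangular set, belongs to `(C) : H_C^∞`. -/
theorem mem_sat_span_of_mem_sat_diffIdeal (hδ : ∀ i j a, δ i (δ j a) = δ j (δ i a))
    (hrank : IsRanking m n) (hC : IsDTriangular C) (hcoh : IsCoherent δ C)
    {p : DiffPoly m n k} (hp : p ∈ supported k (partiallyReducedVars C))
    (h : p ∈ sat (diffIdeal δ C) (initSep C)) : p ∈ sat (Ideal.span C) (initSep C) := by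
  have key : ∀ v, p ∈ sat (Ideal.span (C ∪ prolong δ C (Set.Iic v))) (initSep C) →
      p ∈ sat (Ideal.span C) (initSep C) := by
    have := hrank.wellFoundedLT
    intro v
    induction v using WellFoundedLT.induction with
    | ind v ih =>
      intro hv
      -- Only finitely many prolongations below `v` are used, so they are bounded by some `w < v`.
      rcases exists_mem_sat_prolong_Iic (mem_sat_prolong_Iio hδ hrank hC hcoh hp hv) with
        h | ⟨w, hw, h⟩
      exacts [h, ih w hw h]
  have hle : diffIdeal δ C ≤ Ideal.span (C ∪ prolong δ C Set.univ) :=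
    (diffIdeal_le_span_prolong hδ hC).trans (Ideal.span_mono Set.subset_union_right)
  rcases exists_mem_sat_prolong_Iic (sat_mono hle _ h) with h | ⟨w, -, h⟩
  exacts [h, key w h]

end Rosenfeld

end DiffPoly

namespace DiffPoly

/-! ### Dropping terms as a substitution -/

section Restriction

variable {m n : ℕ} {k : Type*} [Field k]

/-- The substitution of `0` for all the derivatives outside `P`. -/
noncomputable def evalOutsideZero (P : Set (Deriv m n)) : DiffPoly m n k →ₐ[k] DiffPoly m n k :=
  open Classical in aeval fun u => if u ∈ P then X u else 0

/-- Shows that dropping terms is multiplicative, hence compatible with ideals. -/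
theorem restrictTo_eq_evalOutsideZero (P : Set (Deriv m n)) (f : DiffPoly m n k) :
    restrictTo P f = evalOutsideZero P f := by
  classical
  rw [restrictTo, Finset.sum_filter, evalOutsideZero, aeval_def, eval₂_eq]
  refine Finset.sum_congr rfl fun s _ => ?_
  split_ifs with h
  · rw [monomial_eq, algebraMap_eq, Finsupp.prod]
    congr 1
    exact Finset.prod_congr rfl fun u hu => by rw [if_pos (h hu)]
  · obtain ⟨u, hu, huP⟩ := Set.not_subset.1 h
    rw [Finset.prod_eq_zero hu, mul_zero]
    rw [if_neg huP, zero_pow (Finsupp.mem_support_iff.1 hu)]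

theorem evalOutsideZero_of_mem_supported {P : Set (Deriv m n)} {f : DiffPoly m n k}
    (hf : f ∈ supported k P) : evalOutsideZero P f = f := by
  classical
  induction hf using Algebra.adjoin_induction with
  | mem x hx =>
    obtain ⟨u, hu, rfl⟩ := hx
    simp [evalOutsideZero, hu]
  | algebraMap r => exact AlgHom.commutes _ r
  | add x y _ _ hx hy => rw [map_add, hx, hy]
  | mul x y _ _ hx hy => rw [map_mul, hx, hy]

theorem coeff_restrictTo (P : Set (Deriv m n)) (f : DiffPoly m n k) (s : Deriv m n →₀ ℕ)
    [Decidable ((s.support : Set (Deriv m n)) ⊆ P)] :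
    coeff s (restrictTo P f) = if (s.support : Set (Deriv m n)) ⊆ P then coeff s f else 0 := by
  classical
  rw [restrictTo, coeff_sum]
  simp only [coeff_monomial, Finset.sum_ite_eq', Finset.mem_filter, mem_support_iff]
  split_ifs <;> simp_all

theorem support_restrictTo_subset (P : Set (Deriv m n)) (f : DiffPoly m n k) :
    (restrictTo P f).support ⊆ f.support := by
  classical
  intro s hs
  rw [mem_support_iff, coeff_restrictTo] at hs
  rw [mem_support_iff]
  exact fun h => hs (by simp [h])

theorem vars_restrictTo_subset (P : Set (Deriv m n)) (f : DiffPoly m n k) :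
    (restrictTo P f).vars ⊆ f.vars := by
  intro u hu
  obtain ⟨s, hs, hus⟩ := (mem_vars_iff_mem_support u).1 hu
  exact (mem_vars_iff_mem_support u).2 ⟨s, support_restrictTo_subset P f hs, hus⟩

theorem restrictTo_mem_supported (P : Set (Deriv m n)) (f : DiffPoly m n k) :
    restrictTo P f ∈ supported k P := by
  classical
  rw [mem_supported]
  intro u hu
  obtain ⟨s, hs, hus⟩ := (mem_vars_iff_mem_support u).1 hu
  rw [mem_support_iff, coeff_restrictTo] at hs
  by_contra huP
  exact hs (if_neg fun h => huP (h hus))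

theorem Reduced.restrictTo [LinearOrder (Deriv m n)] {f g : DiffPoly m n k} (h : Reduced f g)
    (P : Set (Deriv m n)) : Reduced (restrictTo P f) g := by
  refine ⟨fun u hu v hv => h.1 u hu v (vars_restrictTo_subset P f hv), fun u hu => ?_⟩
  refine lt_of_le_of_lt ?_ (h.2 u hu)
  rw [degreeOf_eq_sup, degreeOf_eq_sup]
  exact Finset.sup_mono (support_restrictTo_subset P f)

theorem maxOrder_le_iff {i : Fin n} {F : Set (DiffPoly m n k)} {N : ℕ} :
    maxOrder i F ≤ N ↔ ∀ f ∈ F, ∀ u ∈ f.vars, u.var = i → u.ord ≤ N := by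
  simp [maxOrder]

/-- Brings order bounds into the form `k[P]`, so that truncation is a case of `restrictTo`. -/
theorem forall_maxOrder_le_iff {F : Set (DiffPoly m n k)} {p : Fin n → ℕ} :
    (∀ i, maxOrder i F ≤ p i) ↔ ∀ f ∈ F, f ∈ supported k {u | u.ord ≤ p u.var} := by
  simp only [maxOrder_le_iff, mem_supported]
  constructor
  · intro h f hf u hu
    exact h _ f hf u hu rfl
  · rintro h _ f hf u hu rfl
    exact h f hf hu

/-- Putting `u = 0` kills every `a i * X u ^ i` with `i > 0` and fixes `a 0`, which is free of `u`.
-/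
theorem restrictTo_compl_singleton_sum {u : Deriv m n} {N : ℕ} {a : ℕ → DiffPoly m n k}
    (ha : ∀ i ≤ N, u ∉ (a i).vars) :
    restrictTo {u}ᶜ (∑ i ∈ Finset.range (N + 1), a i * X u ^ i) = a 0 := by
  have hX : evalOutsideZero {u}ᶜ (X u : DiffPoly m n k) = 0 := by
    simp [evalOutsideZero]
  have ha0 : a 0 ∈ supported k ({u}ᶜ : Set (Deriv m n)) :=
    mem_supported.2 (Set.subset_compl_singleton_iff.2 (ha 0 (Nat.zero_le N)))
  rw [restrictTo_eq_evalOutsideZero, map_sum, Finset.sum_eq_single 0]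
  · rw [pow_zero, mul_one, evalOutsideZero_of_mem_supported ha0]
  · intro i _ hi
    rw [map_mul, map_pow, hX, zero_pow hi, mul_zero]
  · simp

end Restriction

/-! ### Comparing two remainders -/

section Remainders

variable {m n : ℕ} {k : Type*} [Field k] [LinearOrder (Deriv m n)]
  {δ : Fin m → Derivation ℤ k k} {C : Set (DiffPoly m n k)}

/-- The substitution fixes the generators of `(C)`, and also the multipliers, since initials and
separants involve only derivatives occurring in `C`. -/
theorem evalOutsideZero_mem_sat {P : Set (Deriv m n)} (hP : ∀ c ∈ C, c ∈ supported k P)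
    {a : DiffPoly m n k} (ha : a ∈ sat (Ideal.span C) (initSep C)) :
    evalOutsideZero P a ∈ sat (Ideal.span C) (initSep C) := by
  obtain ⟨s, hs, hsa⟩ := ha
  refine ⟨s, hs, ?_⟩
  have hle : Ideal.span C ≤ (Ideal.span C).comap (evalOutsideZero P) := by
    refine Ideal.span_le.2 fun c hc => ?_
    change evalOutsideZero P c ∈ Ideal.span C
    rw [evalOutsideZero_of_mem_supported (hP c hc)]
    exact Ideal.subset_span hc
  have h : evalOutsideZero P (s * a) ∈ Ideal.span C := hle hsa
  rwa [map_mul, evalOutsideZero_of_mem_supported (closure_initSep_subset_supported hP hs)] at h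

theorem IsDiffRemainder.mem_supported {f g : DiffPoly m n k} (hg : IsDiffRemainder δ C f g) :
    g ∈ supported k (partiallyReducedVars C) :=
  MvPolynomial.mem_supported.2 fun w hw c hc u hu => (hg.1 c hc).1 u hu w hw

/-- If the derivatives occurring in `C` and in one differential remainder of `f` belong to `P`,
then dropping the terms outside `k[P]` from another differential remainder changes it by an
element of `(C) : H_C^∞` and yields a differential remainder. -/
theorem IsDiffRemainder.restrictTo (hδ : ∀ i j a, δ i (δ j a) = δ j (δ i a))
    (hrank : IsRanking m n) (hC : IsDTriangular C) (hcoh : IsCoherent δ C)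
    {f g g' : DiffPoly m n k} (hg : IsDiffRemainder δ C f g) (hg' : IsDiffRemainder δ C f g')
    {P : Set (Deriv m n)} (hCP : ∀ c ∈ C, c ∈ supported k P) (hgP : g ∈ supported k P) :
    g' - DiffPoly.restrictTo P g' ∈ sat (Ideal.span C) (initSep C) ∧
      IsDiffRemainder δ C f (DiffPoly.restrictTo P g') := by
  obtain ⟨h, hh, hfg⟩ := hg.2
  obtain ⟨h', hh', hfg'⟩ := hg'.2
  have hCN : ∀ c ∈ C, c ∈ supported k (partiallyReducedVars C) := fun c hc =>
    hC.mem_supported_partiallyReducedVars hrank hc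
  -- Cross-multiplication eliminates `f`.
  have hmem : h * g' - h' * g ∈ sat (Ideal.span C) (initSep C) := by
    refine mem_sat_span_of_mem_sat_diffIdeal hδ hrank hC hcoh ?_ ?_
    · exact sub_mem (mul_mem (closure_initSep_subset_supported hCN hh) hg'.mem_supported)
        (mul_mem (closure_initSep_subset_supported hCN hh') hg.mem_supported)
    · have e : h * g' - h' * g = h' * (h * f - g) - h * (h' * f - g') := by ring
      rw [e]
      exact Ideal.sub_mem _ (Ideal.mul_mem_left _ _ hfg) (Ideal.mul_mem_left _ _ hfg')
  have hres := evalOutsideZero_mem_sat hCP hmem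
  rw [map_sub, map_mul, map_mul, evalOutsideZero_of_mem_supported hgP,
    evalOutsideZero_of_mem_supported (closure_initSep_subset_supported hCP hh),
    evalOutsideZero_of_mem_supported (closure_initSep_subset_supported hCP hh'),
    ← restrictTo_eq_evalOutsideZero] at hres
  have hdiff : g' - DiffPoly.restrictTo P g' ∈ sat (Ideal.span C) (initSep C) := by
    refine mem_sat_of_mul_mem hh ?_
    have e : h * (g' - DiffPoly.restrictTo P g') =
        (h * g' - h' * g) - (h * DiffPoly.restrictTo P g' - h' * g) := by ring
    rw [e]
    exact Ideal.sub_mem _ hmem hres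
  refine ⟨hdiff, fun c hc => (hg'.1 c hc).restrictTo P, h', hh', ?_⟩
  have e : h' * f - DiffPoly.restrictTo P g' =
      (h' * f - g') + (g' - DiffPoly.restrictTo P g') := by ring
  rw [e]
  exact Ideal.add_mem _ hfg' (sat_mono span_le_diffIdeal _ hdiff)

end Remainders

end DiffPoly

theorem mainTheorem5 {m n : ℕ} {k : Type*} [Field k] [CharZero k]
    (δ : Fin m → Derivation ℤ k k) (hδ : ∀ i j a, δ i (δ j a) = δ j (δ i a))
    [LinearOrder (Deriv m n)] (hrank : IsRanking m n)
    (C : Set (DiffPoly m n k)) (hC : DiffPoly.IsDTriangular C)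
    (hcoh : DiffPoly.IsCoherent δ C) (f : DiffPoly m n k) :
    -- two remainders, a single derivative `u` that is not present in `C` and `g`
    (∀ g g' : DiffPoly m n k,
      DiffPoly.IsDiffRemainder δ C f g → DiffPoly.IsDiffRemainder δ C f g' →
      ∀ u ∉ DiffPoly.derivativesIn (C ∪ {g}), ∀ (N : ℕ) (a : ℕ → DiffPoly m n k),
        (∀ i ≤ N, u ∉ (a i).vars) →
        g' = ∑ i ∈ Finset.range (N + 1), a i * MvPolynomial.X u ^ i →
        g' - a 0 ∈ DiffPoly.sat (Ideal.span C) (DiffPoly.initSep C) ∧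
          DiffPoly.IsDiffRemainder δ C f (a 0)) ∧
    -- two remainders, all the derivatives that are not present in `C` and `g`
    (∀ g g' : DiffPoly m n k,
      DiffPoly.IsDiffRemainder δ C f g → DiffPoly.IsDiffRemainder δ C f g' →
      g' - DiffPoly.restrictTo (DiffPoly.derivativesIn (C ∪ {g})) g' ∈
          DiffPoly.sat (Ideal.span C) (DiffPoly.initSep C) ∧
        DiffPoly.IsDiffRemainder δ C f
          (DiffPoly.restrictTo (DiffPoly.derivativesIn (C ∪ {g})) g')) ∧
    -- truncation
    (∀ p : Fin n → ℕ, (∀ i, DiffPoly.maxOrder i C ≤ p i) →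
      (∃ g, DiffPoly.IsDiffRemainder δ C f g ∧ ∀ i, DiffPoly.maxOrder i {g} ≤ p i) →
      ∀ g, DiffPoly.IsDiffRemainder δ C f g →
        DiffPoly.IsDiffRemainder δ C f (DiffPoly.truncate p g) ∧
          ∀ i, DiffPoly.maxOrder i {DiffPoly.truncate p g} ≤ p i) := by
  refine ⟨fun g g' hg hg' u hu N a ha hsum => ?_, fun g g' hg hg' => ?_, fun p hp => ?_⟩
  · have hfree : ∀ c ∈ C ∪ {g}, c ∈ supported k ({u}ᶜ : Set (Deriv m n)) := fun c hc =>
      mem_supported.2 (Set.subset_compl_singleton_iff.2 fun huc => hu ⟨c, hc, huc⟩)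
    have h := hg.restrictTo hδ hrank hC hcoh hg' (fun c hc => hfree c (Or.inl hc))
      (hfree g (Or.inr rfl))
    rwa [hsum, DiffPoly.restrictTo_compl_singleton_sum ha, ← hsum] at h
  · have hX : ∀ c ∈ C ∪ {g}, c ∈ supported k (DiffPoly.derivativesIn (C ∪ {g})) := fun c hc =>
      mem_supported.2 fun u hu => ⟨c, hc, hu⟩
    exact hg.restrictTo hδ hrank hC hcoh hg' (fun c hc => hX c (Or.inl hc)) (hX g (Or.inr rfl))
  -- The assumed remainder `g₀` of bounded order is the reference; the arbitrary `g` is the one cut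
  -- down.
  · rintro ⟨g₀, hg₀, hp₀⟩ g hg
    refine ⟨(hg₀.restrictTo hδ hrank hC hcoh hg (DiffPoly.forall_maxOrder_le_iff.1 hp)
      (DiffPoly.forall_maxOrder_le_iff.1 hp₀ g₀ rfl)).2, ?_⟩
    rw [DiffPoly.forall_maxOrder_le_iff]
    rintro _ rfl
    exact DiffPoly.restrictTo_mem_supported _ _
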